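/- Let $K$ be an algebraically closed field of characteristic zero and let $(A,\mathfrak m)$ be an Artin local $K$-algebra, i.e. a local $K$-algebra of finite dimension over $K$ (equivalently, up to isomorphism, an Artin quotient $A=R/I$ of a formal power series ring $R=K[[x_1,\dots,x_m]]$). Put $h_i(A)=\dim_K \mathfrak m^i/\mathfrak m^{i+1}$, let $n=h_1(A)$ be the embedding dimension of $A$, and let $s$ be its socle degree, i.e. the largest integer $j$ with $\mathfrak m^j\neq 0$. Suppose that $A$ is an extremal (compressed) Gorenstein algebra, that is, $\dim_K(0:\mathfrak m)=1$ and $$h_i(A)=\min\left\{\binom{n+i-1}{i},\ \binom{n+s-i-1}{s-i}\right\}\qquad\text{for } 0\le i\le s,$$ where $\binom{n+j-1}{j}$ denotes the dimension of the space of forms of degree $j$ in $n$ variables (so it equals $1$ for $n=j=0$). If $s\le 4$, then $A$ is canonically graded: there is an isomorphism of $K$-algebras between $A$ and its associated graded ring $gr_{\mathfrak m}(A)=\bigoplus_{i\ge 0}\mathfrak m^i/\mathfrak m^{i+1}$. -/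

import Mathlib

open scoped DirectSum

/-- The `i`-th graded piece `I ^ i / I ^ (i + 1)` of the `I`-adic filtration of `A`. -/
def GradedPiece {A : Type*} [CommRing A] (I : Ideal A) (i : ℕ) : Type _ :=
  ↥(I ^ i) ⧸ (I ^ (i + 1)).submoduleOf (I ^ i)

namespace GradedPiece

noncomputable section

variable {A : Type*} [CommRing A] (I : Ideal A)

instance (i : ℕ) : AddCommGroup (GradedPiece I i) :=
  inferInstanceAs (AddCommGroup (↥(I ^ i) ⧸ (I ^ (i + 1)).submoduleOf (I ^ i)))

/-- `I ^ i / I ^ (i + 1)` is a module over every ring over which `A` is an algebra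
(in particular over `A` itself). -/
instance {K : Type*} [CommRing K] [Algebra K A] (i : ℕ) : Module K (GradedPiece I i) :=
  inferInstanceAs (Module K (↥(I ^ i) ⧸ (I ^ (i + 1)).submoduleOf (I ^ i)))

/-- The class in `I ^ i / I ^ (i + 1)` of an element of `I ^ i`. -/
def mk (i : ℕ) : ↥(I ^ i) →ₗ[A] GradedPiece I i :=
  ((I ^ (i + 1)).submoduleOf (I ^ i)).mkQ

variable {I}

theorem mk_surjective (i : ℕ) : Function.Surjective (mk I i) :=
  Submodule.mkQ_surjective _

theorem mk_eq_zero_iff {i : ℕ} (a : ↥(I ^ i)) : mk I i a = 0 ↔ (a : A) ∈ I ^ (i + 1) :=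
  Submodule.Quotient.mk_eq_zero _

theorem smul_mk {K : Type*} [CommRing K] [Algebra K A] {i : ℕ} (r : K) (a : ↥(I ^ i)) :
    r • mk I i a = mk I i (r • a) := rfl

theorem gradedMonoid_mk_congr {i j : ℕ} (h : i = j) (a : ↥(I ^ i)) (b : ↥(I ^ j))
    (hab : (a : A) = b) :
    (GradedMonoid.mk i (mk I i a) : GradedMonoid (GradedPiece I)) =
      GradedMonoid.mk j (mk I j b) := by
  subst h
  have : a = b := Subtype.ext hab
  rw [this]

variable (I)

/-- The multiplication `I ^ i × I ^ j → I ^ (i + j)` of `A`. -/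
def powMul (i j : ℕ) : ↥(I ^ i) →ₗ[A] ↥(I ^ j) →ₗ[A] ↥(I ^ (i + j)) :=
  LinearMap.mk₂ A
    (fun a b => ⟨(a : A) * b, by rw [pow_add]; exact Ideal.mul_mem_mul a.2 b.2⟩)
    (fun _ _ _ => Subtype.ext (add_mul _ _ _))
    (fun _ _ _ => Subtype.ext (mul_assoc _ _ _))
    (fun _ _ _ => Subtype.ext (mul_add _ _ _))
    (fun _ _ _ => Subtype.ext (mul_left_comm _ _ _))

/-- The multiplication `I ^ i / I ^ (i + 1) × I ^ j / I ^ (j + 1) → I ^ (i + j) / I ^ (i + j + 1)`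
induced by the multiplication of `A`. -/
def mul (i j : ℕ) : GradedPiece I i →ₗ[A] GradedPiece I j →ₗ[A] GradedPiece I (i + j) :=
  Submodule.liftQ _
    { toFun := fun a => Submodule.liftQ _ ((mk I (i + j)).comp (powMul I i j a)) (by
        intro b hb
        refine (mk_eq_zero_iff _).2 ?_
        have hb' : (b : A) ∈ I ^ (j + 1) := hb
        change (a : A) * b ∈ I ^ (i + j + 1)
        rw [add_assoc, pow_add]
        exact Ideal.mul_mem_mul a.2 hb')
      map_add' := fun a a' => by
        apply LinearMap.ext
        intro b
        obtain ⟨b, rfl⟩ := mk_surjective j b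
        change mk I (i + j) (powMul I i j (a + a') b) =
          mk I (i + j) (powMul I i j a b) + mk I (i + j) (powMul I i j a' b)
        rw [map_add, LinearMap.add_apply, map_add]
      map_smul' := fun r a => by
        apply LinearMap.ext
        intro b
        obtain ⟨b, rfl⟩ := mk_surjective j b
        change mk I (i + j) (powMul I i j (r • a) b) = r • mk I (i + j) (powMul I i j a b)
        rw [map_smul, LinearMap.smul_apply, map_smul] }
    (by
      intro a ha
      apply LinearMap.ext
      intro b
      obtain ⟨b, rfl⟩ := mk_surjective j b
      refine (mk_eq_zero_iff (powMul I i j a b)).2 ?_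
      have ha' : (a : A) ∈ I ^ (i + 1) := ha
      change (a : A) * b ∈ I ^ (i + j + 1)
      rw [add_right_comm, pow_add]
      exact Ideal.mul_mem_mul ha' b.2)

theorem mul_mk_mk {i j : ℕ} (a : ↥(I ^ i)) (b : ↥(I ^ j)) :
    mul I i j (mk I i a) (mk I j b) = mk I (i + j) (powMul I i j a b) := rfl

/-- The class of `a : A` in `A / I = I ^ 0 / I ^ 1`. -/
def ofRing : A →ₗ[A] GradedPiece I 0 :=
  (mk I 0).comp (LinearMap.codRestrict (I ^ 0) LinearMap.id (fun a => by simp))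

instance : GradedMonoid.GMul (GradedPiece I) where
  mul {i j} a b := mul I i j a b

instance : GradedMonoid.GOne (GradedPiece I) where
  one := ofRing I 1

instance : DirectSum.GCommRing (GradedPiece I) where
  mul_zero {i j} a := map_zero (mul I i j a)
  zero_mul {i j} b := LinearMap.map_zero₂ (mul I i j) b
  mul_add {i j} a b c := map_add (mul I i j a) b c
  add_mul {i j} a b c := LinearMap.map_add₂ (mul I i j) a b c
  one_mul := by
    rintro ⟨i, a⟩
    obtain ⟨a, rfl⟩ := mk_surjective i a
    exact gradedMonoid_mk_congr (zero_add i) _ _ (one_mul (a : A))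
  mul_one := by
    rintro ⟨i, a⟩
    obtain ⟨a, rfl⟩ := mk_surjective i a
    exact gradedMonoid_mk_congr (add_zero i) _ _ (mul_one (a : A))
  mul_assoc := by
    rintro ⟨i, a⟩ ⟨j, b⟩ ⟨k, c⟩
    obtain ⟨a, rfl⟩ := mk_surjective i a
    obtain ⟨b, rfl⟩ := mk_surjective j b
    obtain ⟨c, rfl⟩ := mk_surjective k c
    exact gradedMonoid_mk_congr (add_assoc i j k) _ _ (mul_assoc (a : A) b c)
  mul_comm := by
    rintro ⟨i, a⟩ ⟨j, b⟩
    obtain ⟨a, rfl⟩ := mk_surjective i a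
    obtain ⟨b, rfl⟩ := mk_surjective j b
    exact gradedMonoid_mk_congr (add_comm i j) _ _ (mul_comm (a : A) b)
  natCast n := ofRing I n
  natCast_zero := by rw [Nat.cast_zero, map_zero]
  natCast_succ n := by rw [Nat.cast_succ, map_add]; rfl
  intCast n := ofRing I n
  intCast_ofNat n := by rw [Int.cast_natCast]
  intCast_negSucc_ofNat n := by rw [Int.cast_negSucc, map_neg]

instance {K : Type*} [CommRing K] [Algebra K A] : DirectSum.GAlgebra K (GradedPiece I) where
  toFun := (ofRing I).toAddMonoidHom.comp (algebraMap K A).toAddMonoidHom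
  map_one := congrArg (ofRing I) (map_one (algebraMap K A))
  map_mul r s := gradedMonoid_mk_congr (zero_add 0).symm _ _ (map_mul (algebraMap K A) r s)
  commutes := by
    rintro r ⟨i, a⟩
    obtain ⟨a, rfl⟩ := mk_surjective i a
    exact gradedMonoid_mk_congr ((zero_add i).trans (add_zero i).symm) _ _
      (mul_comm (algebraMap K A r) (a : A))
  smul_def := by
    rintro r ⟨i, a⟩
    obtain ⟨a, rfl⟩ := mk_surjective i a
    exact gradedMonoid_mk_congr (zero_add i).symm (r • a) _ (Algebra.smul_def r (a : A))

end

end GradedPiece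

/-- The associated graded ring `⨁ i, I ^ i / I ^ (i + 1)`; its commutative ring structure and its
`K`-algebra structure come from the graded multiplication above. -/
abbrev AssociatedGradedRing {A : Type*} [CommRing A] (I : Ideal A) : Type _ :=
  ⨁ i, GradedPiece I i

/-- The Hilbert function `h_i(A) = dim_K (𝔪 ^ i / 𝔪 ^ (i + 1))` of a local `K`-algebra. -/
noncomputable def localHilbertFunction (K A : Type*) [Field K] [CommRing A] [IsLocalRing A]
    [Algebra K A] (i : ℕ) : ℕ :=
  Module.finrank K (GradedPiece (IsLocalRing.maximalIdeal A) i)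

/-- The embedding dimension `dim_K (𝔪 / 𝔪 ^ 2)` of a local `K`-algebra. -/
noncomputable def embeddingDim (K A : Type*) [Field K] [CommRing A] [IsLocalRing A]
    [Algebra K A] : ℕ :=
  localHilbertFunction K A 1

/-- The socle `0 : 𝔪` of a local ring. -/
noncomputable def localSocle (A : Type*) [CommRing A] [IsLocalRing A] : Ideal A :=
  Submodule.annihilator (IsLocalRing.maximalIdeal A)

/-- `s` is the socle degree of the local ring `A`: the largest `j` with `𝔪 ^ j ≠ 0`. -/
def IsSocleDegree (A : Type*) [CommRing A] [IsLocalRing A] (s : ℕ) : Prop :=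
  IsGreatest {j : ℕ | IsLocalRing.maximalIdeal A ^ j ≠ ⊥} s

/-- `A` is an extremal (or compressed) Gorenstein local `K`-algebra of socle degree `s`
(to be used for Artin local `K`-algebras with residue field `K`): the socle of `A` is
one-dimensional and, `n` being the embedding dimension of `A`,
`h_i(A) = min {binom (n + i - 1) i, binom (n + s - i - 1) (s - i)}` for `0 ≤ i ≤ s`.
The entries of the minimum are the dimensions of the spaces of forms of degrees `i` and `s - i`
in `n` variables (for `n = 0` and degree `0` truncated subtraction gives
`Nat.choose 0 0 = 1`, as it should). -/
structure IsExtremalGorenstein (K A : Type*) [Field K] [CommRing A] [IsLocalRing A] [Algebra K A]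
    (s : ℕ) : Prop where
  isSocleDegree : IsSocleDegree A s
  finrank_socle : Module.finrank K (localSocle A) = 1
  hilbertFunction_eq : ∀ i ≤ s, localHilbertFunction K A i =
    min (Nat.choose (embeddingDim K A + i - 1) i)
      (Nat.choose (embeddingDim K A + (s - i) - 1) (s - i))

/-- A local `K`-algebra is canonically graded if it is isomorphic, as a `K`-algebra, to the
associated graded ring of its maximal ideal. -/
def IsCanonicallyGraded (K A : Type*) [Field K] [CommRing A] [IsLocalRing A] [Algebra K A] :
    Prop :=
  Nonempty (A ≃ₐ[K] AssociatedGradedRing (IsLocalRing.maximalIdeal A))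

/-!
Let `s` be the socle degree and `𝔪` the maximal ideal. For a family `a` of generators of `𝔪`, let
`W_d` be the span of the monomials of degree `d` in `a`, so that `𝔪 ^ d = W_d + 𝔪 ^ (d + 1)`. A
linear functional `φ` on `A` that does not vanish on `𝔪 ^ s` (the socle) induces a nondegenerate
pairing `φ (x * y)`. The idea is to choose `a` and `φ` so that `φ` vanishes on `W_d` for all `d ≠
s`. Then `W_d` and `W_e` are orthogonal unless `d + e = s`, which forces the sum of the `W_d` to
be direct and `W_d → 𝔪 ^ d / 𝔪 ^ (d + 1)` to be bijective; as `W_d W_e ⊆ W_{d + e}`, this is an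
isomorphism of `A` with its associated graded ring (`nonempty_algEquiv_associatedGradedRing`).

Since `s ≤ 4`, the Hilbert function is maximal in degrees less than `s - 1`: the monomials of
these degrees are a basis of a complement of `𝔪 ^ (s - 1)`. So the values of `φ` on them may be
changed to zero without affecting `φ` on `𝔪 ^ (s - 1)`, and the values in degrees above `s` are
zero anyway. Only degree `s - 1` remains. There the generators are replaced by `a i + b i` with `b
i ∈ 𝔪 ^ 2`. To first order this changes a monomial by a derivation, and all further terms lie in
`𝔪 ^ (s + 1) = 0`; so it is enough that `φ (b i * M) = -(s - 1)⁻¹ φ (a i * M)` for the monomials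
`M` of degree `s - 2` (`map_prod_mul_prod_map_add`). The right-hand side can be extended to a
functional vanishing on `𝔪 ^ (s - 1)`, again because the monomials of degree less than `s - 1` are
independent. By duality this functional is `φ (b i * ·)` for some `b i` in the orthogonal of `𝔪 ^
(s - 1)`, which is `𝔪 ^ 2` because the Hilbert function is symmetric
(`exists_mem_pow_forall_eq_mul`). For `s ≤ 1` no correction of the generators is needed.
-/

/-! ### Spans of monomials of given degree -/

section MonomialSpan

variable {K A ι : Type*} [Field K] [CommRing A] [Algebra K A]

/-- The `K`-span of the monomials of degree `d` in the family `a`; a monomial is encoded by the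
multiset of its factors. -/
def monomialSpan (K : Type*) {A ι : Type*} [Field K] [CommRing A] [Algebra K A] (a : ι → A)
    (d : ℕ) : Submodule K A :=
  Submodule.span K {x | ∃ t : Multiset ι, t.card = d ∧ (t.map a).prod = x}

theorem prod_mem_monomialSpan (a : ι → A) (t : Multiset ι) :
    (t.map a).prod ∈ monomialSpan K a t.card :=
  Submodule.subset_span ⟨t, rfl, rfl⟩

theorem one_mem_monomialSpan (a : ι → A) : (1 : A) ∈ monomialSpan K a 0 := by
  simpa using prod_mem_monomialSpan (K := K) a 0

theorem span_range_le_monomialSpan (a : ι → A) :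
    Submodule.span K (Set.range a) ≤ monomialSpan K a 1 := by
  refine Submodule.span_le.2 ?_
  rintro _ ⟨i, rfl⟩
  simpa using prod_mem_monomialSpan (K := K) a {i}

theorem mul_mem_monomialSpan {a : ι → A} {d e : ℕ} {x y : A} (hx : x ∈ monomialSpan K a d)
    (hy : y ∈ monomialSpan K a e) : x * y ∈ monomialSpan K a (d + e) := by
  have h := Submodule.mul_mem_mul hx hy
  rw [monomialSpan, monomialSpan, Submodule.span_mul_span] at h
  refine Submodule.span_mono ?_ h
  rintro _ ⟨_, ⟨t, rfl, rfl⟩, _, ⟨u, rfl, rfl⟩, rfl⟩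
  exact ⟨t + u, by simp, by simp⟩

theorem prod_map_mem_pow {I : Ideal A} {a : ι → A} (ha : ∀ i, a i ∈ I) (t : Multiset ι) :
    (t.map a).prod ∈ I ^ t.card := by
  induction t using Multiset.induction_on with
  | empty => simp
  | cons i t ih =>
    rw [Multiset.map_cons, Multiset.prod_cons, Multiset.card_cons, pow_succ']
    exact Ideal.mul_mem_mul (ha i) ih

theorem monomialSpan_le_pow {I : Ideal A} {a : ι → A} (ha : ∀ i, a i ∈ I) (d : ℕ) :
    monomialSpan K a d ≤ (I ^ d).restrictScalars K := by
  refine Submodule.span_le.2 ?_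
  rintro _ ⟨t, rfl, rfl⟩
  exact prod_map_mem_pow ha t

/-- If every element of `A` is a scalar modulo `I` and `I` is spanned by the `a i` modulo `I ^ 2`,
then `I ^ d` is spanned modulo `I ^ (d + 1)` by the monomials of degree `d`. -/
theorem exists_monomialSpan_sub_mem {I : Ideal A} {a : ι → A} (ha : ∀ i, a i ∈ I)
    (h0 : ∀ x : A, ∃ c : K, x - algebraMap K A c ∈ I)
    (h1 : I.restrictScalars K ≤ Submodule.span K (Set.range a) ⊔ (I ^ 2).restrictScalars K)
    (d : ℕ) {x : A} (hx : x ∈ I ^ d) :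
    ∃ y ∈ monomialSpan K a d, x - y ∈ I ^ (d + 1) := by
  induction d generalizing x with
  | zero =>
    obtain ⟨c, hc⟩ := h0 x
    refine ⟨c • 1, Submodule.smul_mem _ _ (one_mem_monomialSpan a), ?_⟩
    simpa [Algebra.smul_def] using hc
  | succ d ih =>
    rw [pow_succ] at hx
    refine Submodule.mul_induction_on hx ?_ ?_
    · intro z hz w hw
      obtain ⟨z', hz', hzz⟩ := ih hz
      obtain ⟨w', hw', w'', hww, rfl⟩ := Submodule.mem_sup.1 (h1 hw)
      replace hw' := span_range_le_monomialSpan a hw'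
      refine ⟨z' * w', mul_mem_monomialSpan hz' hw', ?_⟩
      have e : z * (w' + w'') - z' * w' = (z - z') * (w' + w'') + z' * w'' := by ring
      rw [e]
      refine add_mem ?_ ?_
      · rw [pow_succ]
        exact Ideal.mul_mem_mul hzz hw
      · rw [add_assoc, pow_add]
        exact Ideal.mul_mem_mul (monomialSpan_le_pow ha d hz') hww
    · rintro z w ⟨z', hz', hzz⟩ ⟨w', hw', hww⟩
      refine ⟨z' + w', add_mem hz' hw', ?_⟩
      rw [add_sub_add_comm]
      exact add_mem hzz hww

theorem exists_mem_iSup_monomialSpan_sub_mem {I : Ideal A} {a : ι → A}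
    (hspan : ∀ d, ∀ x ∈ I ^ d, ∃ y ∈ monomialSpan K a d, x - y ∈ I ^ (d + 1)) (k : ℕ) (x : A) :
    ∃ y ∈ ⨆ d : Fin k, monomialSpan K a d, x - y ∈ I ^ k := by
  induction k with
  | zero => exact ⟨0, zero_mem _, by simp⟩
  | succ k ih =>
    obtain ⟨y, hy, hxy⟩ := ih
    obtain ⟨z, hz, hyz⟩ := hspan k _ hxy
    refine ⟨y + z, add_mem ?_ ?_, by rwa [← sub_sub]⟩
    · refine (iSup_le fun d : Fin k => ?_ :
        (⨆ d : Fin k, monomialSpan K a d) ≤ ⨆ d : Fin (k + 1), monomialSpan K a d) hy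
      exact le_iSup (fun d : Fin (k + 1) => monomialSpan K a d) d.castSucc
    · exact le_iSup (fun d : Fin (k + 1) => monomialSpan K a d) (Fin.last k) hz

theorem iSup_monomialSpan_eq_top {I : Ideal A} {a : ι → A} {s : ℕ} (hs : I ^ (s + 1) = ⊥)
    (hspan : ∀ d, ∀ x ∈ I ^ d, ∃ y ∈ monomialSpan K a d, x - y ∈ I ^ (d + 1)) :
    ⨆ d, monomialSpan K a d = ⊤ := by
  refine eq_top_iff.2 fun x _ => ?_
  obtain ⟨y, hy, hxy⟩ := exists_mem_iSup_monomialSpan_sub_mem hspan (s + 1) x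
  rw [hs, Ideal.mem_bot, sub_eq_zero] at hxy
  rw [hxy]
  exact (iSup_le fun d : Fin (s + 1) => le_iSup (monomialSpan K a) d :
    (⨆ d : Fin (s + 1), monomialSpan K a d) ≤ _) hy

end MonomialSpan

/-! ### Recognizing the associated graded ring by a functional -/

section Grading

variable {K A ι : Type*} [Field K] [CommRing A] [Algebra K A]

/-- `GradedPiece.mk` as a map linear over the ground field. -/
noncomputable def gradedPieceMk (K : Type*) {A : Type*} [Field K] [CommRing A] [Algebra K A]
    (I : Ideal A) (d : ℕ) : (I ^ d).restrictScalars K →ₗ[K] GradedPiece I d where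
  toFun x := GradedPiece.mk I d ⟨x, x.2⟩
  map_add' x y := map_add (GradedPiece.mk I d) ⟨x, x.2⟩ ⟨y, y.2⟩
  map_smul' _ _ := rfl

theorem gradedPieceMk_surjective (I : Ideal A) (d : ℕ) :
    Function.Surjective (gradedPieceMk K I d) := fun x => by
  obtain ⟨y, rfl⟩ := GradedPiece.mk_surjective d x
  exact ⟨⟨y, y.2⟩, rfl⟩

theorem gradedPieceMk_eq_zero_iff {I : Ideal A} {d : ℕ} (x : (I ^ d).restrictScalars K) :
    gradedPieceMk K I d x = 0 ↔ (x : A) ∈ I ^ (d + 1) :=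
  GradedPiece.mk_eq_zero_iff _

/-- If a nondegenerate pairing `φ (x * y)` comes from a functional `φ` vanishing on all monomials of
degree different from `s`, then the spans of the monomials of degree `d` form a grading of `A`, and
`A` is isomorphic to its associated graded ring. -/
theorem nonempty_algEquiv_associatedGradedRing {I : Ideal A} {a : ι → A} {s : ℕ}
    (ha : ∀ i, a i ∈ I) (hs : I ^ (s + 1) = ⊥)
    (hspan : ∀ d, ∀ x ∈ I ^ d, ∃ y ∈ monomialSpan K a d, x - y ∈ I ^ (d + 1))
    (φ : A →ₗ[K] K) (hφ : ∀ x, (∀ y, φ (x * y) = 0) → x = 0)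
    (hvan : ∀ d, d ≠ s → ∀ y ∈ monomialSpan K a d, φ y = 0) :
    Nonempty (A ≃ₐ[K] AssociatedGradedRing I) := by
  have htop := iSup_monomialSpan_eq_top hs hspan
  have hzero : ∀ x : A, (∀ e, ∀ z ∈ monomialSpan K a e, φ (x * z) = 0) → x = 0 := by
    intro x hx
    refine hφ x fun y => ?_
    have hy : y ∈ ⨆ d, monomialSpan K a d := htop ▸ Submodule.mem_top
    induction hy using Submodule.iSup_induction' with
    | mem e z hz => exact hx e z hz
    | zero => simp
    | add z w _ _ hz hw => rw [mul_add, map_add, hz, hw, add_zero]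
  have hdisj : ∀ d, ∀ x ∈ monomialSpan K a d, x ∈ I ^ (d + 1) → x = 0 := by
    intro d x hx hxI
    refine hzero x fun e z hz => ?_
    by_cases hde : d + e = s
    · have h : x * z ∈ I ^ (s + 1) := by
        rw [← hde, add_right_comm, pow_add]
        exact Ideal.mul_mem_mul hxI (monomialSpan_le_pow ha e hz)
      rw [hs, Ideal.mem_bot] at h
      rw [h, map_zero]
    · exact hvan _ hde _ (mul_mem_monomialSpan hx hz)
  have hsurj : ∀ d (x : GradedPiece I d), ∃ y, ∃ hy : y ∈ monomialSpan K a d,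
      GradedPiece.mk I d ⟨y, monomialSpan_le_pow ha d hy⟩ = x := by
    intro d x
    obtain ⟨x, rfl⟩ := GradedPiece.mk_surjective d x
    obtain ⟨y, hy, hxy⟩ := hspan d x x.2
    refine ⟨y, hy, ?_⟩
    rw [← sub_eq_zero, ← map_sub, GradedPiece.mk_eq_zero_iff, ← neg_mem_iff]
    simpa using hxy
  -- `f d` is the inverse of the bijection from `monomialSpan K a d` to `I ^ d / I ^ (d + 1)`.
  have hlift : ∀ d, ∃ f : GradedPiece I d →ₗ[K] A, (∀ x, f x ∈ monomialSpan K a d) ∧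
      (∀ y (hy : y ∈ monomialSpan K a d),
        f (GradedPiece.mk I d ⟨y, monomialSpan_le_pow ha d hy⟩) = y) := by
    intro d
    let g : monomialSpan K a d →ₗ[K] GradedPiece I d :=
      (gradedPieceMk K I d).comp (Submodule.inclusion (monomialSpan_le_pow ha d))
    have hg : Function.Bijective g := by
      constructor
      · refine (injective_iff_map_eq_zero g).2 fun x hx => ?_
        exact Subtype.ext (hdisj d x x.2 ((gradedPieceMk_eq_zero_iff _).1 hx))
      · intro x
        obtain ⟨y, hy, hyx⟩ := hsurj d x
        exact ⟨⟨y, hy⟩, hyx⟩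
    refine ⟨(monomialSpan K a d).subtype.comp (LinearEquiv.ofBijective g hg).symm.toLinearMap,
      fun x => Subtype.prop _, fun y hy => ?_⟩
    exact congrArg Subtype.val ((LinearEquiv.ofBijective g hg).symm_apply_apply ⟨y, hy⟩)
  choose f hfW hfmk using hlift
  let F : AssociatedGradedRing I →ₐ[K] A := DirectSum.toAlgebra K (GradedPiece I) f
    (hfmk 0 1 (one_mem_monomialSpan a)) (by
      intro d e x y
      obtain ⟨x, hx, rfl⟩ := hsurj d x
      obtain ⟨y, hy, rfl⟩ := hsurj e y
      rw [hfmk d x hx, hfmk e y hy]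
      exact hfmk (d + e) (x * y) (mul_mem_monomialSpan hx hy))
  have hFof : ∀ d x, F (DirectSum.of (GradedPiece I) d x) = f d x := fun d x =>
    DirectSum.toAddMonoid_of (fun d => (f d).toAddMonoidHom) d x
  refine ⟨(AlgEquiv.ofBijective F ⟨?_, ?_⟩).symm⟩
  · refine (injective_iff_map_eq_zero F).2 fun x hx => ?_
    classical
    have hsum : F x = ∑ d ∈ DFinsupp.support x, f d (x d) := by
      conv_lhs => rw [← DirectSum.sum_support_of x]
      rw [map_sum]
      exact Finset.sum_congr rfl fun d _ => hFof d _
    ext1 d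
    have hfd : f d (x d) = 0 := by
      by_cases hd : d ∈ DFinsupp.support x
      · refine hzero _ fun e z hz => ?_
        by_cases hde : d + e = s
        · -- Pairing with degree `e = s - d` isolates the component of degree `d`.
          have h : φ (F x * z) = φ (f d (x d) * z) := by
            rw [hsum, Finset.sum_mul, map_sum, Finset.sum_eq_single_of_mem d hd]
            intro d' _ hd'
            exact hvan (d' + e) (by omega) _ (mul_mem_monomialSpan (hfW _ _) hz)
          rw [← h, hx, zero_mul, map_zero]
        · exact hvan _ hde _ (mul_mem_monomialSpan (hfW _ _) hz)
      · rw [DFinsupp.notMem_support_iff.1 hd, map_zero]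
    obtain ⟨y, hy, hyx⟩ := hsurj d (x d)
    rw [← hyx, hfmk d y hy] at hfd
    subst hfd
    rw [← hyx]
    exact map_zero (GradedPiece.mk I d)
  · intro x
    have hx : x ∈ ⨆ d, monomialSpan K a d := htop ▸ Submodule.mem_top
    induction hx using Submodule.iSup_induction' with
    | mem d y hy =>
      exact ⟨DirectSum.of _ d (GradedPiece.mk I d ⟨y, _⟩), (hFof _ _).trans (hfmk d y hy)⟩
    | zero => exact ⟨0, map_zero F⟩
    | add z w _ _ hz hw =>
      obtain ⟨z, rfl⟩ := hz
      obtain ⟨w, rfl⟩ := hw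
      exact ⟨z + w, map_add F z w⟩

end Grading

/-! ### Prescribing functionals, and duality -/

section Duality

variable {K : Type*} [Field K]

/-- If the classes of a finite family `v` span `V / N`, and `v` has at most `dim V / N` members,
then a linear functional may be prescribed freely both on `v` and on `N`. -/
theorem exists_functional_of_span_sup_eq_top {V κ : Type*} [AddCommGroup V] [Module K V]
    [FiniteDimensional K V] [Fintype κ] (N : Submodule K V) (v : κ → V)
    (hv : Submodule.span K (Set.range v) ⊔ N = ⊤)
    (hcard : Fintype.card κ + Module.finrank K N ≤ Module.finrank K V)
    (g : κ → K) (ψ : V →ₗ[K] K) :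
    ∃ θ : V →ₗ[K] K, (∀ x, θ (v x) = g x) ∧ ∀ y ∈ N, θ y = ψ y := by
  have hspan : ⊤ ≤ Submodule.span K (Set.range (N.mkQ ∘ v)) := by
    rw [Set.range_comp, Submodule.span_image, ← Submodule.range_mkQ N, LinearMap.range_eq_map, ← hv,
      Submodule.map_sup, Submodule.mkQ_map_self, sup_bot_eq]
  have hq := N.finrank_quotient_add_finrank
  have hle : Module.finrank K (V ⧸ N) ≤ Fintype.card κ := by
    have h := finrank_range_le_card (R := K) (N.mkQ ∘ v)
    rwa [Set.finrank, top_le_iff.1 hspan, finrank_top] at h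
  let b := basisOfTopLeSpanOfCardEqFinrank (N.mkQ ∘ v) hspan (by omega)
  have hb : ∀ x, b x = N.mkQ (v x) := fun x => by simp [b]
  refine ⟨ψ + (b.constr K fun x => g x - ψ (v x)).comp N.mkQ, fun x => ?_, fun y hy => ?_⟩
  · rw [LinearMap.add_apply, LinearMap.comp_apply, ← hb, Module.Basis.constr_basis, add_sub_cancel]
  · rw [LinearMap.add_apply, LinearMap.comp_apply, Submodule.mkQ_apply,
      (Submodule.Quotient.mk_eq_zero N).2 hy, map_zero, add_zero]

variable {A : Type*} [CommRing A] [Algebra K A]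

theorem finrank_pow_eq_add [Module.Finite K A] (I : Ideal A) (d : ℕ) :
    Module.finrank K ((I ^ d).restrictScalars K) =
      Module.finrank K (GradedPiece I d) + Module.finrank K ((I ^ (d + 1)).restrictScalars K) := by
  rw [← LinearMap.finrank_range_add_finrank_ker (gradedPieceMk K I d),
    LinearMap.range_eq_top.2 (gradedPieceMk_surjective I d), finrank_top]
  congr 1
  have hker : (gradedPieceMk K I d).ker =
      ((I ^ (d + 1)).restrictScalars K).submoduleOf ((I ^ d).restrictScalars K) := by
    ext x
    exact gradedPieceMk_eq_zero_iff x
  rw [hker]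
  have hle : (I ^ (d + 1)).restrictScalars K ≤ (I ^ d).restrictScalars K :=
    Ideal.pow_le_pow_right d.le_succ
  exact (Submodule.submoduleOfEquivOfLe hle).finrank_eq

theorem finrank_eq_sum_add_finrank_pow [Module.Finite K A] (I : Ideal A) (k : ℕ) :
    Module.finrank K A = ∑ d ∈ Finset.range k, Module.finrank K (GradedPiece I d) +
      Module.finrank K ((I ^ k).restrictScalars K) := by
  induction k with
  | zero =>
    rw [Finset.sum_range_zero, zero_add, pow_zero, Ideal.one_eq_top, Submodule.restrictScalars_top,
      finrank_top]
  | succ k ih => rw [ih, finrank_pow_eq_add, Finset.sum_range_succ, add_assoc]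

/-- For a functional `φ` inducing a nondegenerate pairing `φ (x * y)`, the orthogonal of `I ^ k` is
`I ^ j` as soon as it contains `I ^ j` and the dimensions agree; hence every functional vanishing
on `I ^ k` is `φ (b * ·)` for some `b ∈ I ^ j`. -/
theorem exists_mem_pow_forall_eq_mul [Module.Finite K A] {I : Ideal A} {j k : ℕ}
    (hjk : I ^ (j + k) = ⊥)
    (hdim : Module.finrank K ((I ^ j).restrictScalars K) +
      Module.finrank K ((I ^ k).restrictScalars K) = Module.finrank K A)
    (φ : A →ₗ[K] K) (hφ : ∀ x, (∀ y, φ (x * y) = 0) → x = 0)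
    (θ : A →ₗ[K] K) (hθ : ∀ x ∈ I ^ k, θ x = 0) :
    ∃ b ∈ I ^ j, ∀ x, φ (b * x) = θ x := by
  let B : A →ₗ[K] Module.Dual K A := (LinearMap.mul K A).compr₂ φ
  have hB : Function.Injective B := (injective_iff_map_eq_zero B).2 fun x hx =>
    hφ x fun y => LinearMap.congr_fun hx y
  have hmap : ((I ^ j).restrictScalars K).map B =
      ((I ^ k).restrictScalars K).dualAnnihilator := by
    refine Submodule.eq_of_le_of_finrank_eq ?_ ?_
    · rintro _ ⟨b, hb, rfl⟩
      refine (Submodule.mem_dualAnnihilator _).2 fun x hx => ?_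
      have h : b * x ∈ I ^ (j + k) := by
        rw [pow_add]
        exact Ideal.mul_mem_mul hb hx
      rw [hjk, Ideal.mem_bot] at h
      change φ (b * x) = 0
      rw [h, map_zero]
    · have h := Subspace.finrank_add_finrank_dualAnnihilator_eq ((I ^ k).restrictScalars K)
      rw [← (Submodule.equivMapOfInjective B hB _).finrank_eq]
      omega
  have hmem : θ ∈ ((I ^ j).restrictScalars K).map B := by
    rw [hmap]
    exact (Submodule.mem_dualAnnihilator _).2 hθ
  obtain ⟨b, hb, rfl⟩ := hmem
  exact ⟨b, hb, fun x => rfl⟩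

/-- If the dimension of `I ^ d / I ^ (d + 1)` is that of the space of forms of degree `d` for all
`d < k`, then the monomials of degree less than `k` form a basis of a complement of `I ^ k`, so a
functional may be prescribed freely on them and on `I ^ k`. -/
theorem exists_functional_of_choose_le_finrank [Module.Finite K A] {ι : Type*} [Fintype ι]
    {I : Ideal A} {a : ι → A}
    (hspan : ∀ d, ∀ x ∈ I ^ d, ∃ y ∈ monomialSpan K a d, x - y ∈ I ^ (d + 1)) {k : ℕ}
    (hdim : ∀ d < k, (Fintype.card ι + d - 1).choose d ≤ Module.finrank K (GradedPiece I d))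
    (g : Multiset ι → K) (ψ : A →ₗ[K] K) :
    ∃ θ : A →ₗ[K] K, (∀ t : Multiset ι, t.card < k → θ (t.map a).prod = g t) ∧
      ∀ y ∈ I ^ k, θ y = ψ y := by
  classical
  let v : (Σ d : Fin k, Sym ι d) → A := fun x => ((x.2 : Multiset ι).map a).prod
  have hv : Submodule.span K (Set.range v) ⊔ (I ^ k).restrictScalars K = ⊤ := by
    refine eq_top_iff.2 fun x _ => ?_
    obtain ⟨y, hy, hxy⟩ := exists_mem_iSup_monomialSpan_sub_mem hspan k x
    rw [← add_sub_cancel y x]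
    refine Submodule.add_mem_sup ?_ hxy
    refine (iSup_le fun d => Submodule.span_mono ?_ :
      (⨆ d : Fin k, monomialSpan K a d) ≤ _) hy
    rintro _ ⟨t, ht, rfl⟩
    exact ⟨⟨d, t, ht⟩, rfl⟩
  have hcard : Fintype.card (Σ d : Fin k, Sym ι d) +
      Module.finrank K ((I ^ k).restrictScalars K) ≤ Module.finrank K A := by
    rw [finrank_eq_sum_add_finrank_pow I k, Fintype.card_sigma, Finset.sum_range]
    gcongr with d
    rw [Sym.card_sym_eq_choose]
    exact hdim d d.2
  obtain ⟨θ, hθv, hθ⟩ := exists_functional_of_span_sup_eq_top _ v hv hcard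
    (fun x => g (x.2 : Multiset ι)) ψ
  exact ⟨θ, fun t ht => hθv ⟨⟨t.card, ht⟩, t, rfl⟩, hθ⟩

end Duality

/-! ### Perturbing the generators -/

section Deformation

variable {K A ι : Type*} [Field K] [CommRing A] [Algebra K A]

theorem prod_map_add_sub_mem {I : Ideal A} {a b : ι → A} (ha : ∀ i, a i ∈ I)
    (hb : ∀ i, b i ∈ I ^ 2) (t : Multiset ι) :
    (t.map (a + b)).prod - (t.map a).prod ∈ I ^ (t.card + 1) := by
  induction t using Multiset.induction_on with
  | empty => simp
  | cons i t ih =>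
    have hab : ∀ i, (a + b) i ∈ I := fun i =>
      add_mem (ha i) (Ideal.pow_le_self two_ne_zero (hb i))
    simp only [Multiset.map_cons, Multiset.prod_cons, Multiset.card_cons]
    have e : (a + b) i * (t.map (a + b)).prod - a i * (t.map a).prod =
        b i * (t.map (a + b)).prod + a i * ((t.map (a + b)).prod - (t.map a).prod) := by
      rw [Pi.add_apply]
      ring
    rw [e]
    refine add_mem ?_ ?_
    · have h := Ideal.mul_mem_mul (hb i) (prod_map_mem_pow hab t)
      rwa [← pow_add, show 2 + t.card = t.card + 1 + 1 by ring] at h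
    · rw [pow_succ']
      exact Ideal.mul_mem_mul (ha i) ih

/-- A perturbation of the generators by elements of `I ^ 2` acts on the monomials of degree `r + 1`
as a derivation, because products with two factors in `I ^ 2` lie in `I ^ (r + 3) = 0`. If the
perturbation multiplies each factor by `-c` as seen by `φ`, the value of `φ` at a monomial, `t` of
whose factors are perturbed, is multiplied by `1 - t c`. -/
theorem map_prod_mul_prod_map_add {I : Ideal A} {a b : ι → A} {r : ℕ} (ha : ∀ i, a i ∈ I)
    (hb : ∀ i, b i ∈ I ^ 2) (hs : I ^ (r + 3) = ⊥) (φ : A →ₗ[K] K) (c : K)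
    (hφb : ∀ i (t : Multiset ι), t.card = r →
      φ (b i * (t.map a).prod) = -c * φ (a i * (t.map a).prod))
    (t u : Multiset ι) (htu : t.card + u.card = r + 1) :
    φ ((u.map a).prod * (t.map (a + b)).prod) =
      (1 - t.card * c) * φ ((u.map a).prod * (t.map a).prod) := by
  induction t using Multiset.induction_on generalizing u with
  | empty => simp
  | cons i t ih =>
    rw [Multiset.card_cons] at htu
    have h1 := ih (i ::ₘ u) (by rw [Multiset.card_cons]; omega)
    have h2 := hφb i (u + t) (by rw [Multiset.card_add]; omega)
    have h3 : b i * (u.map a).prod * ((t.map (a + b)).prod - (t.map a).prod) = 0 := by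
      have h := Ideal.mul_mem_mul (Ideal.mul_mem_mul (hb i) (prod_map_mem_pow ha u))
        (prod_map_add_sub_mem ha hb t)
      rwa [← pow_add, ← pow_add, show 2 + u.card + (t.card + 1) = r + 3 by omega, hs,
        Ideal.mem_bot] at h
    simp only [Multiset.map_cons, Multiset.prod_cons, Multiset.card_cons, Multiset.map_add,
      Multiset.prod_add] at h1 h2 ⊢
    have e1 : (u.map a).prod * ((a + b) i * (t.map (a + b)).prod) =
        a i * (u.map a).prod * (t.map (a + b)).prod +
          b i * ((u.map a).prod * (t.map a).prod) +
          b i * (u.map a).prod * ((t.map (a + b)).prod - (t.map a).prod) := by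
      rw [Pi.add_apply]
      ring
    have e2 : (u.map a).prod * (a i * (t.map a).prod) =
        a i * (u.map a).prod * (t.map a).prod := by ring
    have e3 : a i * ((u.map a).prod * (t.map a).prod) =
        a i * (u.map a).prod * (t.map a).prod := by ring
    rw [e1, h3, add_zero, map_add, h1, h2, e2, e3]
    push_cast
    ring

/-- It suffices that `φ` vanishes at the monomials of degree `d` for `k ≤ d < s`: those of degree
less than `k` are independent modulo `I ^ k`, so `φ` can be made to vanish there without changing
it on `I ^ k`. -/
theorem nonempty_algEquiv_associatedGradedRing_of_vanishing [Module.Finite K A] [Fintype ι]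
    {I : Ideal A} {a : ι → A} {s k : ℕ} (ha : ∀ i, a i ∈ I) (hs : I ^ (s + 1) = ⊥)
    (hspan : ∀ d, ∀ x ∈ I ^ d, ∃ y ∈ monomialSpan K a d, x - y ∈ I ^ (d + 1)) (hk : k ≤ s)
    (hdim : ∀ d < k, (Fintype.card ι + d - 1).choose d ≤ Module.finrank K (GradedPiece I d))
    (hnondeg : ∀ φ : A →ₗ[K] K, (∃ y ∈ I ^ s, φ y ≠ 0) → ∀ x, (∀ y, φ (x * y) = 0) → x = 0)
    (φ : A →ₗ[K] K) (hφ : ∃ y ∈ I ^ s, φ y ≠ 0)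
    (hvan : ∀ t : Multiset ι, k ≤ t.card → t.card < s → φ (t.map a).prod = 0) :
    Nonempty (A ≃ₐ[K] AssociatedGradedRing I) := by
  obtain ⟨θ, hθ, hθφ⟩ := exists_functional_of_choose_le_finrank hspan hdim (fun _ => 0) φ
  refine nonempty_algEquiv_associatedGradedRing ha hs hspan θ (hnondeg θ ?_) fun d hd => ?_
  · obtain ⟨y, hy, hφy⟩ := hφ
    exact ⟨y, hy, by rwa [hθφ y (Ideal.pow_le_pow_right hk hy)]⟩
  · refine (Submodule.span_le (p := LinearMap.ker θ)).2 ?_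
    rintro _ ⟨t, rfl, rfl⟩
    change θ _ = 0
    have ht := prod_map_mem_pow ha t
    rcases lt_or_ge t.card k with htk | htk
    · exact hθ t htk
    rw [hθφ _ (Ideal.pow_le_pow_right htk ht)]
    rcases hd.lt_or_gt with hts | hts
    · exact hvan t htk hts
    · have h := Ideal.pow_le_pow_right hts ht
      rw [hs, Ideal.mem_bot] at h
      rw [h, map_zero]

/-- The case of a Hilbert function that is maximal in degrees less than `r + 1`, the largest
exponent with `I ^ s ≠ 0` being `s = r + 2`. The hypothesis `hsymm` says that the orthogonal of `I
^ (s - 1)` is `I ^ 2`. -/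
theorem nonempty_algEquiv_associatedGradedRing_of_choose_le [CharZero K] [Module.Finite K A]
    [Fintype ι] {I : Ideal A} {a : ι → A} {r : ℕ} (ha : ∀ i, a i ∈ I) (hs : I ^ (r + 3) = ⊥)
    (h0 : ∀ x : A, ∃ c : K, x - algebraMap K A c ∈ I)
    (h1 : I.restrictScalars K ≤ Submodule.span K (Set.range a) ⊔ (I ^ 2).restrictScalars K)
    (hdim : ∀ d < r + 1, (Fintype.card ι + d - 1).choose d ≤ Module.finrank K (GradedPiece I d))
    (hsymm : Module.finrank K ((I ^ 2).restrictScalars K) +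
      Module.finrank K ((I ^ (r + 1)).restrictScalars K) = Module.finrank K A)
    (hnondeg : ∀ φ : A →ₗ[K] K, (∃ y ∈ I ^ (r + 2), φ y ≠ 0) →
      ∀ x, (∀ y, φ (x * y) = 0) → x = 0)
    (φ : A →ₗ[K] K) (hφ : ∃ y ∈ I ^ (r + 2), φ y ≠ 0) :
    Nonempty (A ≃ₐ[K] AssociatedGradedRing I) := by
  have hspan : ∀ d, ∀ x ∈ I ^ d, ∃ y ∈ monomialSpan K a d, x - y ∈ I ^ (d + 1) :=
    fun d x hx => exists_monomialSpan_sub_mem ha h0 h1 d hx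
  have hb : ∀ i, ∃ b ∈ I ^ 2, ∀ t : Multiset ι, t.card = r →
      φ (b * (t.map a).prod) = -((r : K) + 1)⁻¹ * φ (a i * (t.map a).prod) := by
    intro i
    obtain ⟨θ, hθ, hθI⟩ := exists_functional_of_choose_le_finrank hspan hdim
      (fun t => -((r : K) + 1)⁻¹ * φ (a i * (t.map a).prod)) 0
    obtain ⟨b, hb, hbθ⟩ := exists_mem_pow_forall_eq_mul (j := 2) (k := r + 1)
      (by rwa [show 2 + (r + 1) = r + 3 by ring]) hsymm φ (hnondeg φ hφ) θ hθI
    exact ⟨b, hb, fun t ht => by rw [hbθ, hθ t (by omega)]⟩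
  choose b hb hbφ using hb
  -- In a monomial of degree `r + 1` all `r + 1` factors are perturbed, so `c = (r + 1)⁻¹` in
  -- `map_prod_mul_prod_map_add` makes the factor `1 - (r + 1) c` vanish.
  have hab : ∀ i, (a + b) i ∈ I := fun i =>
    add_mem (ha i) (Ideal.pow_le_self two_ne_zero (hb i))
  have h1' : I.restrictScalars K ≤
      Submodule.span K (Set.range (a + b)) ⊔ (I ^ 2).restrictScalars K := by
    refine h1.trans (sup_le (Submodule.span_le.2 ?_) le_sup_right)
    rintro _ ⟨i, rfl⟩
    have e : a i = (a + b) i + -b i := by simp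
    rw [e]
    exact Submodule.add_mem_sup (Submodule.subset_span ⟨i, rfl⟩) (neg_mem (hb i))
  refine nonempty_algEquiv_associatedGradedRing_of_vanishing (k := r + 1) (s := r + 2) hab hs
    (fun d x hx => exists_monomialSpan_sub_mem hab h0 h1' d hx) (Nat.le_succ _) hdim hnondeg φ hφ
    fun t ht hts => ?_
  have htr : t.card = r + 1 := by omega
  have h := map_prod_mul_prod_map_add ha hb hs φ _ hbφ t 0 (by simpa using htr)
  have hr : (r : K) + 1 ≠ 0 := by exact_mod_cast r.succ_ne_zero
  rw [htr, Nat.cast_add_one, mul_inv_cancel₀ hr, sub_self, zero_mul] at h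
  simpa using h

end Deformation

/-! ### Local algebras -/

section Local

open IsLocalRing

variable {K A : Type*} [Field K] [CommRing A] [IsLocalRing A] [Algebra K A]

/-- Every nonzero ideal meets the socle, so in a local ring with one-dimensional socle a functional
that is nonzero on the socle induces a nondegenerate pairing. -/
theorem eq_zero_of_forall_map_mul_eq_zero {s : ℕ} (hs : maximalIdeal A ^ (s + 1) = ⊥)
    (hsoc : Module.finrank K (localSocle A) = 1) (φ : A →ₗ[K] K)
    (hφ : ∃ y ∈ maximalIdeal A ^ s, φ y ≠ 0) (x : A) (hx : ∀ y, φ (x * y) = 0) : x = 0 := by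
  by_contra hx0
  have hex : ∃ k, ∀ z ∈ maximalIdeal A ^ k, x * z = 0 :=
    ⟨s + 1, fun z hz => by rw [hs, Ideal.mem_bot] at hz; rw [hz, mul_zero]⟩
  classical
  -- If `k + 1` is the least exponent with `x 𝔪 ^ (k + 1) = 0`, then `x 𝔪 ^ k` is nonzero and lies
  -- in the socle.
  obtain ⟨k, hk⟩ : ∃ k, Nat.find hex = k + 1 := by
    refine Nat.exists_eq_succ_of_ne_zero fun h => hx0 ?_
    have h' := Nat.find_spec hex
    rw [h] at h'
    simpa using h' 1 (by simp)
  have hmin := Nat.find_min hex (m := k) (by omega)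
  push Not at hmin
  obtain ⟨z, hz, hxz⟩ := hmin
  have hxz_mem : x * z ∈ localSocle A := by
    refine Submodule.mem_annihilator.2 fun w hw => ?_
    have h := Nat.find_spec hex
    rw [hk] at h
    rw [smul_eq_mul, mul_assoc]
    exact h _ (by rw [pow_succ]; exact Ideal.mul_mem_mul hz hw)
  obtain ⟨y, hy, hφy⟩ := hφ
  have hy_mem : y ∈ localSocle A := by
    refine Submodule.mem_annihilator.2 fun w hw => ?_
    have h : y * w ∈ maximalIdeal A ^ (s + 1) := by
      rw [pow_succ]
      exact Ideal.mul_mem_mul hy hw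
    rwa [hs, Ideal.mem_bot] at h
  obtain ⟨c, hc⟩ := (finrank_eq_one_iff_of_nonzero' (⟨x * z, hxz_mem⟩ : localSocle A)
    (fun h => hxz (congrArg Subtype.val h))).1 hsoc ⟨y, hy_mem⟩
  have hc' : c • (x * z) = y := congrArg Subtype.val hc
  exact hφy (by rw [← hc', map_smul, hx, smul_zero])

theorem exists_sub_algebraMap_mem_maximalIdeal [IsAlgClosed K] [Module.Finite K A] (x : A) :
    ∃ c : K, x - algebraMap K A c ∈ maximalIdeal A := by
  have : Module.Finite K (ResidueField A) :=
    Module.Finite.of_surjective (IsScalarTower.toAlgHom K A (ResidueField A)).toLinearMap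
      residue_surjective
  obtain ⟨c, hc⟩ := (IsAlgClosed.algebraMap_bijective_of_isIntegral
    (k := K) (K := ResidueField A)).2 (residue A x)
  refine ⟨c, ?_⟩
  rw [← residue_eq_zero_iff, map_sub, ← hc, sub_eq_zero]
  exact IsScalarTower.algebraMap_apply K A (ResidueField A) c

/-- Lifts of a basis of `I / I ^ 2` generate `I` modulo `I ^ 2`. -/
theorem exists_generators_mod_sq {A : Type*} [CommRing A] [Algebra K A] [Module.Finite K A]
    (I : Ideal A) :
    ∃ a : Fin (Module.finrank K (GradedPiece I 1)) → A, (∀ i, a i ∈ I) ∧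
      I.restrictScalars K ≤ Submodule.span K (Set.range a) ⊔ (I ^ 2).restrictScalars K := by
  have : Module.Finite K (GradedPiece I 1) :=
    Module.Finite.of_surjective (gradedPieceMk K I 1) (gradedPieceMk_surjective I 1)
  let e := Module.finBasis K (GradedPiece I 1)
  choose a ha using fun i => gradedPieceMk_surjective (K := K) I 1 (e i)
  refine ⟨fun i => a i, fun i => by simpa using (a i).2, fun x hx => ?_⟩
  let x' : (I ^ 1).restrictScalars K := ⟨x, by simpa using hx⟩
  let y := ∑ i, e.repr (gradedPieceMk K I 1 x') i • a i
  have hy : gradedPieceMk K I 1 (x' - y) = 0 := by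
    rw [map_sub, map_sum, sub_eq_zero]
    simp only [map_smul, ha]
    exact (e.sum_repr _).symm
  rw [gradedPieceMk_eq_zero_iff] at hy
  have hxy : x = (y : A) + ((x' - y : (I ^ 1).restrictScalars K) : A) := by simp [x']
  rw [hxy]
  refine Submodule.add_mem_sup ?_ hy
  simp only [y, Submodule.coe_sum, Submodule.coe_smul]
  exact Submodule.sum_mem _ fun i _ => Submodule.smul_mem _ _ (Submodule.subset_span ⟨i, rfl⟩)

theorem one_le_localHilbertFunction_zero (K A : Type*) [Field K] [CommRing A] [IsLocalRing A]
    [Algebra K A] [Module.Finite K A] : 1 ≤ localHilbertFunction K A 0 := by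
  by_contra! h
  have h' := finrank_pow_eq_add (K := K) (maximalIdeal A) 0
  rw [show Module.finrank K (GradedPiece (maximalIdeal A) 0) = 0 by
    simpa [localHilbertFunction] using h, zero_add] at h'
  have h'' := Submodule.eq_of_le_of_finrank_eq
    (Ideal.pow_le_pow_right (Nat.zero_le 1) :
      (maximalIdeal A ^ (0 + 1)).restrictScalars K ≤
        (maximalIdeal A ^ 0).restrictScalars K) h'.symm
  have h1 : (1 : A) ∈ (maximalIdeal A ^ (0 + 1)).restrictScalars K := by
    rw [h'']
    simp
  simp at h1

end Local

theorem mainTheorem1 {K : Type*} [Field K] [IsAlgClosed K] [CharZero K]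
    {A : Type*} [CommRing A] [IsLocalRing A] [Algebra K A] [Module.Finite K A]
    {s : ℕ} (hA : IsExtremalGorenstein K A s) (hs : s ≤ 4) :
    IsCanonicallyGraded K A := by
  obtain ⟨⟨hs0, hsmax⟩, hsoc, hH⟩ := hA
  have hs1 : IsLocalRing.maximalIdeal A ^ (s + 1) = ⊥ := by
    by_contra h
    exact absurd (hsmax h) (by omega)
  obtain ⟨y, hy, hy0⟩ := Submodule.exists_mem_ne_zero_of_ne_bot hs0
  obtain ⟨φ, hφ⟩ : ∃ φ : A →ₗ[K] K, φ y ≠ 0 := by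
    by_contra! h
    exact hy0 ((Module.forall_dual_apply_eq_zero_iff K y).1 h)
  obtain ⟨a, ha, h1⟩ := exists_generators_mod_sq (K := K) (IsLocalRing.maximalIdeal A)
  have h0 := exists_sub_algebraMap_mem_maximalIdeal (K := K) (A := A)
  have hnondeg := eq_zero_of_forall_map_mul_eq_zero (K := K) hs1 hsoc
  have hH0 := one_le_localHilbertFunction_zero K A
  -- For `s ≤ 1` there is no degree `d` with `s ≤ d < s` to correct: `k = s`.
  rcases Nat.lt_or_ge s 2 with hs2 | hs2
  · refine nonempty_algEquiv_associatedGradedRing_of_vanishing (k := s) ha hs1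
      (fun d x hx => exists_monomialSpan_sub_mem ha h0 h1 d hx) le_rfl (fun d hd => ?_) hnondeg φ
      ⟨y, hy, hφ⟩ fun t ht hts => absurd hts (by omega)
    obtain rfl : d = 0 := by omega
    rw [Nat.choose_zero_right]
    exact hH0
  · obtain ⟨r, rfl⟩ := Nat.exists_eq_add_of_le' hs2
    refine nonempty_algEquiv_associatedGradedRing_of_choose_le (r := r) ha hs1 h0 h1
      (fun d hd => ?_) ?_ hnondeg φ ⟨y, hy, hφ⟩
    · rw [Fintype.card_fin]
      change (embeddingDim K A + d - 1).choose d ≤ localHilbertFunction K A d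
      have hd3 : d < 3 := by omega
      interval_cases d
      · simpa using hH0
      · simp [embeddingDim]
      · -- Degree `2 = s - 2` for `s = 4`: both entries of the minimum agree.
        obtain rfl : r = 2 := by omega
        rw [hH 2 (by norm_num)]
        simp
    · have hsymm : ∀ i ≤ r + 2, localHilbertFunction K A (r + 2 - i) =
          localHilbertFunction K A i := by
        intro i hi
        rw [hH i hi, hH _ (Nat.sub_le _ _), min_comm, Nat.sub_sub_self hi]
      have e1 := finrank_eq_sum_add_finrank_pow (K := K) (IsLocalRing.maximalIdeal A) (r + 1)
      have e2 := finrank_eq_sum_add_finrank_pow (K := K) (IsLocalRing.maximalIdeal A) 2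
      have e3 := finrank_eq_sum_add_finrank_pow (K := K) (IsLocalRing.maximalIdeal A) (r + 2 + 1)
      have e4 : Module.finrank K
          ((IsLocalRing.maximalIdeal A ^ (r + 2 + 1)).restrictScalars K) = 0 := by
        rw [hs1, Submodule.restrictScalars_bot, finrank_bot]
      have e5 : ∑ d ∈ Finset.range (r + 2 + 1), localHilbertFunction K A d =
          ∑ d ∈ Finset.range (r + 1), localHilbertFunction K A d +
            ∑ d ∈ Finset.range 2, localHilbertFunction K A d := by
        rw [Finset.sum_range_succ, Finset.sum_range_succ, Finset.sum_range_succ _ 1,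
          Finset.sum_range_one, ← hsymm 0 (by omega), ← hsymm 1 (by omega)]
        simp only [Nat.sub_zero, Nat.add_succ_sub_one]
        ring
      simp only [localHilbertFunction] at e5
      omega
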